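/- A simple binary matroid $M$ of rank $r=r(M)\ge 1$ is a subset of $\mathbb{F}_2^r\setminus\{0\}$ that spans $\mathbb{F}_2^r$. Its critical number $\chi(M)$ is the smallest $c$ such that some subspace of $\mathbb{F}_2^r$ of codimension $c$ is disjoint from $M$ (the critical number of the restriction $M\cap H$ of $M$ to a subspace $H$ is defined in the same way inside $H$). $M$ contains $N$ if there is an injective linear map $\iota:\mathbb{F}_2^{r(N)}\to\mathbb{F}_2^{r(M)}$ with $\iota(N)\subseteq M$. The critical threshold $\theta(N)$ is the infimum of all $\alpha>0$ for which there exists $c<\infty$ such that every simple binary matroid $M$ with $|M|\ge\alpha 2^{r(M)}$ contains $N$ or satisfies $\chi(M)\le c$. For $\ell\ge 2$ let $N_{\ell,2,1}$ be the rank-$\ell$ matroid $(\mathbb{F}_2^\ell\setminus W)\cup\{v\}$, where $W$ is a subspace of $\mathbb{F}_2^\ell$ of codimension $1$ (so $\mathbb{F}_2^\ell\setminus W$ is the Bose–Burton geometry $BB(\ell,1)$) and $v$ is a nonzero vector of $W$; up to linear isomorphism it does not depend on $W$ and $v$. **Proposition.** For every $\ell\ge 2$, $\theta(N_{\ell,2,1})=\frac14$.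 In particular $N=N_{\ell,2,1}$ satisfies the Geelen–Nelson conjecture: with $c=\chi(N)$ one has $\theta(N)=1-i\,2^{-c}$ for some $i\in\{2,3,4\}$, where $i=2$ if and only if no subspace $S$ of codimension $c-1$ has $S\cap N$ linearly independent, and $i=4$ if and only if $N$ is $c$-near-independent. Here $N$ is $c$-near-independent if $\chi(N)=c$ and there is a subspace $H$ of codimension $c-2$ with $\chi(N\cap H)=2$ that has a subspace $S$ of codimension $1$ in $H$ such that $N\cap S$ is linearly independent and every circuit (minimal linearly dependent subset) of odd size in $N\cap H$ contains at least four elements of $H\setminus S$. -/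

import Mathlib

/-- A simple binary matroid: a full-rank (spanning) subset of `𝔽₂ ^ r \ {0}`
for some positive integer `r`, the rank. -/
structure BinMatroid where
  rank : ℕ
  rank_pos : 0 < rank
  carrier : Set (Fin rank → ZMod 2)
  zero_notMem : 0 ∉ carrier
  span_eq_top : Submodule.span (ZMod 2) carrier = ⊤

namespace BinMatroid

/-- The critical number of a set `X ⊆ 𝔽₂ ^ n \ {0}`: the smallest `c` such that some subspace
of codimension `c` is disjoint from `X`. It does not change when `𝔽₂ ^ n` is
replaced by a subspace that contains `X`, so it is also the critical number of the restriction
of a matroid to a subspace. -/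
noncomputable def criticalNumberOf {n : ℕ} (X : Set (Fin n → ZMod 2)) : ℕ :=
  sInf {c : ℕ | ∃ W : Submodule (ZMod 2) (Fin n → ZMod 2),
    Module.finrank (ZMod 2) W + c = n ∧ Disjoint (W : Set (Fin n → ZMod 2)) X}

/-- The critical number `χ(M)`. -/
noncomputable def criticalNumber (M : BinMatroid) : ℕ := criticalNumberOf M.carrier

/-- `M` contains a copy of `N`: some linear injection maps `N` into `M`. -/
def Contains (M N : BinMatroid) : Prop :=
  ∃ ι : (Fin N.rank → ZMod 2) →ₗ[ZMod 2] (Fin M.rank → ZMod 2),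
    Function.Injective ι ∧ ι '' N.carrier ⊆ M.carrier

/-- The set of all `α > 0` for which there is `c` such that `|M| ≥ α 2 ^ r(M)` implies that `M`
contains `N` or `χ(M) ≤ c`. -/
def thresholdSet (N : BinMatroid) : Set ℝ :=
  {α : ℝ | 0 < α ∧ ∃ c : ℕ, ∀ M : BinMatroid,
    α * 2 ^ M.rank ≤ (M.carrier.ncard : ℝ) → M.Contains N ∨ M.criticalNumber ≤ c}

/-- The critical threshold `θ(N)`. -/
noncomputable def criticalThreshold (N : BinMatroid) : ℝ := sInf N.thresholdSet

/-- `B` is a Bose-Burton geometry `BB(n, c)`: the complement of a subspace of codimension `c`. -/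
def IsBoseBurton {n : ℕ} (c : ℕ) (B : Set (Fin n → ZMod 2)) : Prop :=
  ∃ W : Submodule (ZMod 2) (Fin n → ZMod 2),
    Module.finrank (ZMod 2) W + c = n ∧ B = (W : Set (Fin n → ZMod 2))ᶜ

/-- `N` is (a copy of) `N_{ℓ,c,k}`: it has rank `ℓ` and is the union of a `BB(ℓ, c - 1)` with `k`
linearly independent vectors of the complement of that `BB(ℓ, c - 1)`. It is meant
for `1 < c` and `c + k - 1 ≤ ℓ`. -/
def IsNFamily (ℓ c k : ℕ) (N : BinMatroid) : Prop :=
  N.rank = ℓ ∧ ∃ B : Set (Fin N.rank → ZMod 2), IsBoseBurton (c - 1) B ∧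
    ∃ v : Fin k → (Fin N.rank → ZMod 2),
      LinearIndependent (ZMod 2) v ∧ (∀ i, v i ∈ Bᶜ) ∧ N.carrier = B ∪ Set.range v

/-- A circuit of the set `X` of vectors: a minimal linearly dependent subset. -/
def IsCircuitOf {n : ℕ} (X C : Set (Fin n → ZMod 2)) : Prop :=
  C ⊆ X ∧ ¬ LinearIndepOn (ZMod 2) id C ∧ ∀ D, D ⊂ C → LinearIndepOn (ZMod 2) id D

/-- `M` is `c`-near-independent. -/
def NearIndependent (c : ℕ) (M : BinMatroid) : Prop :=
  M.criticalNumber = c ∧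
    ∃ H : Submodule (ZMod 2) (Fin M.rank → ZMod 2),
      Module.finrank (ZMod 2) H + c = M.rank + 2 ∧
      criticalNumberOf (M.carrier ∩ H) = 2 ∧
      ∃ S : Submodule (ZMod 2) (Fin M.rank → ZMod 2), S ≤ H ∧
        Module.finrank (ZMod 2) S + 1 = Module.finrank (ZMod 2) H ∧
        LinearIndepOn (ZMod 2) id (M.carrier ∩ S) ∧
        ∀ C, IsCircuitOf (M.carrier ∩ H) C → Odd C.ncard →
          4 ≤ (C \ (S : Set (Fin M.rank → ZMod 2))).ncard

/-- Some subspace `S` of codimension `c - 1` meets `N` in a linearly independent set. -/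
def HasIndependentFlat (c : ℕ) (N : BinMatroid) : Prop :=
  ∃ S : Submodule (ZMod 2) (Fin N.rank → ZMod 2),
    Module.finrank (ZMod 2) S + c = N.rank + 1 ∧ LinearIndepOn (ZMod 2) id (N.carrier ∩ S)

/-- The assertion of the Geelen-Nelson conjecture for the matroid `N`: with `c = χ(N)`,
`θ(N) = 1 - i 2 ^ (-c)` where `i ∈ {2, 3, 4}`, `i = 2` iff `N` has no independent flat of
codimension `c - 1`, and `i = 4` iff `N` is `c`-near-independent. -/
def SatisfiesGeelenNelson (N : BinMatroid) : Prop :=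
  ∃ i : ℕ, (i = 2 ∨ i = 3 ∨ i = 4) ∧
    (i = 2 ↔ ¬ N.HasIndependentFlat N.criticalNumber) ∧
    (i = 4 ↔ N.NearIndependent N.criticalNumber) ∧
    N.criticalThreshold = 1 - (i : ℝ) / 2 ^ N.criticalNumber

/-- The infimum in `criticalThreshold` is over a nonempty set that is bounded below. -/
theorem isGLB_criticalThreshold (N : BinMatroid) :
    IsGLB N.thresholdSet N.criticalThreshold := by
  refine isGLB_csInf ⟨2, by norm_num, 0, fun M h => ?_⟩ ⟨0, fun α h => h.1.le⟩
  exfalso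
  have h1 : M.carrier.ncard ≤ 2 ^ M.rank := by
    have := Set.ncard_le_card M.carrier
    simpa [Nat.card_eq_fintype_card] using this
  have h2 : (M.carrier.ncard : ℝ) ≤ 2 ^ M.rank := by exact_mod_cast h1
  have h3 : (0 : ℝ) < 2 ^ M.rank := by positivity
  linarith

/-- The infimum in `criticalNumberOf` is over a nonempty set when `0 ∉ X`. -/
theorem criticalNumberOf_spec {n : ℕ} {X : Set (Fin n → ZMod 2)} (hX : 0 ∉ X) :
    ∃ W : Submodule (ZMod 2) (Fin n → ZMod 2),
      Module.finrank (ZMod 2) W + criticalNumberOf X = n ∧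
        Disjoint (W : Set (Fin n → ZMod 2)) X := by
  refine Nat.sInf_mem (s := {c : ℕ | ∃ W : Submodule (ZMod 2) (Fin n → ZMod 2),
    Module.finrank (ZMod 2) W + c = n ∧ Disjoint (W : Set (Fin n → ZMod 2)) X}) ⟨n, ⊥, ?_⟩
  simpa using hX

/-- The matroids `N_{ℓ,c,k}` exist in the intended range. -/
theorem exists_isNFamily {ℓ c k : ℕ} (hc : 1 < c) (hℓ : c + k ≤ ℓ + 1) :
    ∃ N : BinMatroid, IsNFamily ℓ c k N := by
  have hpos : 0 < ℓ := by omega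
  obtain ⟨u, hu⟩ : ∃ u : Fin (ℓ - (c - 1)) → (Fin ℓ → ZMod 2), LinearIndependent (ZMod 2) u := by
    refine ⟨fun i => Pi.basisFun (ZMod 2) (Fin ℓ) (Fin.castLE (by omega) i), ?_⟩
    exact (Pi.basisFun (ZMod 2) (Fin ℓ)).linearIndependent.comp _ (Fin.castLE_injective _)
  set W := Submodule.span (ZMod 2) (Set.range u) with hW
  have hrank : Module.finrank (ZMod 2) W + (c - 1) = ℓ := by
    rw [hW, finrank_span_eq_card hu, Fintype.card_fin]; omega
  have hne : ∃ a, a ∉ W := by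
    by_contra! h
    have : W = ⊤ := by ext x; simp [h x]
    rw [this, finrank_top, Module.finrank_pi, Fintype.card_fin] at hrank
    omega
  obtain ⟨a, ha⟩ := hne
  have hk : k ≤ ℓ - (c - 1) := by omega
  set v : Fin k → (Fin ℓ → ZMod 2) := fun i => u (Fin.castLE hk i) with hv
  have hvi : LinearIndependent (ZMod 2) v := hu.comp _ (Fin.castLE_injective _)
  have hvW : ∀ i, v i ∈ W := fun i => Submodule.subset_span ⟨_, rfl⟩
  refine ⟨⟨ℓ, hpos, (W : Set _)ᶜ ∪ Set.range v, ?_, ?_⟩, rfl, (W : Set _)ᶜ, ⟨W, hrank, rfl⟩,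
    v, hvi, fun i => by simpa using hvW i, rfl⟩
  · rintro (h | ⟨i, hi⟩)
    · exact h W.zero_mem
    · exact hvi.ne_zero i hi
  · rw [eq_top_iff]
    intro x _
    have hmem : ∀ y, y ∉ W →
        y ∈ Submodule.span (ZMod 2) ((W : Set (Fin ℓ → ZMod 2))ᶜ ∪ Set.range v) :=
      fun y hy => Submodule.subset_span (Or.inl hy)
    by_cases hx : x ∈ W
    · have h1 : x + a ∉ W := fun h => ha ((Submodule.add_mem_iff_right _ hx).1 h)
      simpa using Submodule.sub_mem _ (hmem _ h1) (hmem _ ha)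
    · exact hmem x hx

end BinMatroid

/-! Upper bound: let `M` have density at least `1/4 + ε`. If some `v ∈ M` is a popular difference,
the set of `x` with `x, x + v ∈ M` is dense and invariant under `v`. Repeated averaging
(`exists_coset_subset_of_dense`) puts in it a coset of an `(ℓ - 1)`-dimensional subspace containing
`v`, and this coset together with `v` is a copy of `N`.

If every `v ∈ M` is a rare difference, `M` has few triangles. Averaging the indicator of `M` over
cosets of the annihilator `H` of its large Fourier coefficients hardly increases the triangle count.
If `H` contained some `v ∈ M`, rarity of `v` would keep all averages near or below `1/2`. As their
mean is at least `1/4 + ε`, they would be non-negligible on more than half of the space, which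
forces many triangles. So `H` misses `M`, and its codimension bounds the critical number
(`exists_subspace_disjoint_of_rare`).

Lower bound: `N` contains a triangle, while the sets `borsukHajnalSet` are triangle-free with
density approaching `1/4` and unbounded critical number.

Finally `χ(N) = 2`, the hyperplane `W` meets `N` in one vector, and a triangle rules out
near-independence. Hence `i = 3`, in accordance with `1/4 = 1 - 3/4`. -/

theorem exists_linearEquiv_apply_eq {K V V' : Type*} [Field K] [AddCommGroup V] [Module K V]
    [AddCommGroup V'] [Module K V'] [FiniteDimensional K V] [FiniteDimensional K V']
    (h : Module.finrank K V = Module.finrank K V') {v : V} {v' : V'} (hv : v ≠ 0) (hv' : v' ≠ 0) :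
    ∃ e : V ≃ₗ[K] V', e v = v' := by
  obtain ⟨C, hC⟩ := Submodule.exists_isCompl (K ∙ v)
  obtain ⟨C', hC'⟩ := Submodule.exists_isCompl (K ∙ v')
  have h1 := Submodule.finrank_add_eq_of_isCompl hC
  have h2 := Submodule.finrank_add_eq_of_isCompl hC'
  rw [finrank_span_singleton hv] at h1
  rw [finrank_span_singleton hv'] at h2
  let e₀ : C ≃ₗ[K] C' := LinearEquiv.ofFinrankEq C C' (by omega)
  let e₁ := (LinearEquiv.toSpanNonzeroSingleton K V v hv).symm.trans
    (LinearEquiv.toSpanNonzeroSingleton K V' v' hv')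
  refine ⟨(Submodule.prodEquivOfIsCompl _ _ hC).symm.trans
    ((e₁.prodCongr e₀).trans (Submodule.prodEquivOfIsCompl _ _ hC')), ?_⟩
  have h3 : (Submodule.prodEquivOfIsCompl _ _ hC).symm v =
      (LinearEquiv.toSpanNonzeroSingleton K V v hv 1, 0) := by
    rw [LinearEquiv.symm_apply_eq]; simp
  simp only [e₁, LinearEquiv.trans_apply, h3, LinearEquiv.prodCongr_apply,
    LinearEquiv.symm_apply_apply]
  simp

theorem exists_ker_eq_of_finrank_add_one {V : Type*} [AddCommGroup V] [Module (ZMod 2) V]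
    [FiniteDimensional (ZMod 2) V] {W : Submodule (ZMod 2) V}
    (hW : Module.finrank (ZMod 2) W + 1 = Module.finrank (ZMod 2) V) :
    ∃ (φ : V →ₗ[ZMod 2] ZMod 2) (a : V), φ a = 1 ∧ ∀ x, x ∈ W ↔ φ x = 0 := by
  have hlt : W < ⊤ := lt_top_iff_ne_top.2 fun h => by
    rw [h, finrank_top] at hW; omega
  obtain ⟨φ, hφ, hle⟩ := Submodule.exists_le_ker_of_lt_top W hlt
  obtain ⟨a, ha⟩ : ∃ a, φ a ≠ 0 := by
    by_contra! h
    exact hφ (LinearMap.ext h)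
  have hlt' : LinearMap.ker φ < ⊤ := lt_top_iff_ne_top.2 fun h =>
    ha (by rw [← LinearMap.mem_ker, h]; trivial)
  have h1 := Submodule.finrank_lt hlt'.ne
  have h2 : W = LinearMap.ker φ := Submodule.eq_of_le_of_finrank_le hle (by omega)
  refine ⟨φ, a, ?_, fun x => by rw [h2, LinearMap.mem_ker]⟩
  generalize φ a = t at ha
  revert t; decide

theorem ZMod.two_eq_one_of_ne_zero {t : ZMod 2} (ht : t ≠ 0) : t = 1 := by
  revert t; decide

/-! ### Copies of `N_{ℓ,2,1}` and its invariants. -/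

namespace BinMatroid

/-- The structure of `N_{ℓ,2,1}`: the complement of a hyperplane, with one nonzero vector of the
hyperplane added. -/
theorem IsNFamily.exists_hyperplane {ℓ : ℕ} {N : BinMatroid} (hN : IsNFamily ℓ 2 1 N) :
    ∃ (W : Submodule (ZMod 2) (Fin N.rank → ZMod 2)) (w : Fin N.rank → ZMod 2),
      Module.finrank (ZMod 2) W + 1 = N.rank ∧ w ∈ W ∧ w ≠ 0 ∧
        N.carrier = (W : Set (Fin N.rank → ZMod 2))ᶜ ∪ {w} := by
  obtain ⟨-, B, ⟨W, hW, rfl⟩, v, hv, hvW, hc⟩ := hN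
  refine ⟨W, v 0, hW, by simpa using hvW 0, hv.ne_zero 0, ?_⟩
  rw [hc]
  congr 1
  ext x
  simp [eq_comm]

/-- A matroid contains `N_{ℓ,2,1}` as soon as it contains an affine subspace of dimension `ℓ - 1`
together with a nonzero vector of its direction. -/
theorem contains_of_affine_subset {M N : BinMatroid}
    {W : Submodule (ZMod 2) (Fin N.rank → ZMod 2)} {w : Fin N.rank → ZMod 2}
    (hW : Module.finrank (ZMod 2) W + 1 = N.rank) (hwW : w ∈ W) (hw : w ≠ 0)
    (hN : N.carrier = (W : Set (Fin N.rank → ZMod 2))ᶜ ∪ {w})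
    {U : Submodule (ZMod 2) (Fin M.rank → ZMod 2)} {v x : Fin M.rank → ZMod 2}
    (hU : Module.finrank (ZMod 2) U + 1 = N.rank) (hvU : v ∈ U) (hvM : v ∈ M.carrier)
    (hx : ∀ u ∈ U, x + u ∈ M.carrier) : M.Contains N := by
  have hv : v ≠ 0 := fun h => M.zero_notMem (h ▸ hvM)
  have hxU : x ∉ U := fun h => M.zero_notMem <| by
    simpa using hx (-x) (U.neg_mem h)
  obtain ⟨φ, a, ha, hφ⟩ := exists_ker_eq_of_finrank_add_one (W := W) (by simpa using hW)
  obtain ⟨e, he⟩ := exists_linearEquiv_apply_eq (K := ZMod 2) (V := W) (V' := U) (by omega)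
    (v := ⟨w, hwW⟩) (v' := ⟨v, hvU⟩) (by simpa using hw) (by simpa using hv)
  obtain ⟨g, hg⟩ := LinearMap.exists_extend (U.subtype.comp e.toLinearMap)
  have hgW : ∀ y (hy : y ∈ W), g y = e ⟨y, hy⟩ := fun y hy => by
    simpa using congr($hg ⟨y, hy⟩)
  -- The correction term vanishes on `W` and makes `ι a = x`, so the complement of `W` goes into `x
  -- + U`.
  let ι := g + φ.smulRight (x - g a)
  have hι : ∀ y ∈ W, ι y = g y := fun y hy => by simp [ι, (hφ y).1 hy]
  have hι' : ∀ y, y ∉ W → ∃ u ∈ U, ι y = x + u := by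
    intro y hy
    have h1 : φ y = 1 := ZMod.two_eq_one_of_ne_zero fun h => hy ((hφ y).2 h)
    have h2 : y - a ∈ W := (hφ _).2 (by simp [h1, ha])
    refine ⟨g (y - a), ?_, ?_⟩
    · rw [hgW _ h2]; exact (e _).2
    · simp [ι, h1]; abel
  refine ⟨ι, ?_, ?_⟩
  · rw [← LinearMap.ker_eq_bot, LinearMap.ker_eq_bot']
    intro y hy
    by_cases hyW : y ∈ W
    · rw [hι y hyW, hgW y hyW] at hy
      simpa using hy
    · obtain ⟨u, hu, h⟩ := hι' y hyW
      refine absurd ?_ hxU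
      rw [hy] at h
      rw [eq_neg_of_add_eq_zero_left h.symm]
      exact U.neg_mem hu
  · rintro _ ⟨y, hy, rfl⟩
    rw [hN] at hy
    rcases hy with hy | hy
    · obtain ⟨u, hu, h⟩ := hι' y hy
      rw [h]
      exact hx u hu
    · rw [Set.mem_singleton_iff] at hy
      subst hy
      rw [hι _ hwW, hgW _ hwW, he]
      exact hvM

section Family

variable {N : BinMatroid} {W : Submodule (ZMod 2) (Fin N.rank → ZMod 2)} {w : Fin N.rank → ZMod 2}

theorem hasIndependentFlat_two (hW : Module.finrank (ZMod 2) W + 1 = N.rank) (hw : w ≠ 0)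
    (hN : N.carrier = (W : Set (Fin N.rank → ZMod 2))ᶜ ∪ {w}) : N.HasIndependentFlat 2 := by
  refine ⟨W, by omega, (LinearIndepOn.singleton (v := id) hw).mono ?_⟩
  rw [hN]
  rintro x ⟨hx | hx, hxW⟩
  · exact absurd hxW hx
  · exact hx

/-- A subspace missing `N` lies in `W` and omits `w`, so it is proper in `W`; a complement of the
line of `w` in `W` attains the bound. -/
theorem criticalNumber_eq_two (hW : Module.finrank (ZMod 2) W + 1 = N.rank) (hwW : w ∈ W)
    (hw : w ≠ 0) (hN : N.carrier = (W : Set (Fin N.rank → ZMod 2))ᶜ ∪ {w}) :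
    N.criticalNumber = 2 := by
  have hle : N.criticalNumber ≤ 2 := by
    refine Nat.sInf_le ?_
    obtain ⟨C, hC⟩ := Submodule.exists_isCompl (ZMod 2 ∙ (⟨w, hwW⟩ : W))
    have h1 := Submodule.finrank_add_eq_of_isCompl hC
    rw [finrank_span_singleton (by simpa using hw)] at h1
    refine ⟨C.map W.subtype, ?_, ?_⟩
    · rw [Submodule.finrank_map_subtype_eq]; omega
    · rw [Set.disjoint_left, hN]
      rintro _ ⟨y, hy, rfl⟩ (h | h)
      · exact h y.2
      · have h2 : y = ⟨w, hwW⟩ := Subtype.ext h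
        have h3 := Submodule.disjoint_def.1 hC.disjoint y
          (h2 ▸ Submodule.mem_span_singleton_self _) hy
        rw [h3] at h
        exact hw (by simpa using h.symm)
  obtain ⟨S, hS, hd⟩ := criticalNumberOf_spec N.zero_notMem
  change _ + N.criticalNumber = _ at hS
  have hSW : S ≤ W := fun x hx => by
    by_contra h
    exact Set.disjoint_left.1 hd hx (by rw [hN]; exact Or.inl h)
  have hwS : w ∉ S := fun h => Set.disjoint_left.1 hd h (by rw [hN]; exact Or.inr rfl)
  have hlt : S < W := lt_of_le_of_ne hSW fun h => hwS (h ▸ hwW)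
  have := Submodule.finrank_lt_finrank_of_lt hlt
  omega

/-- `N_{ℓ,2,1}` with `ℓ ≥ 2` contains a triangle. -/
theorem exists_triangle (hW : Module.finrank (ZMod 2) W + 1 = N.rank) (hwW : w ∈ W)
    (hN : N.carrier = (W : Set (Fin N.rank → ZMod 2))ᶜ ∪ {w}) :
    ∃ a, w ∈ N.carrier ∧ a ∈ N.carrier ∧ w + a ∈ N.carrier ∧ a ∉ W := by
  obtain ⟨φ, a, ha, hφ⟩ := exists_ker_eq_of_finrank_add_one (W := W) (by simpa using hW)
  have haW : a ∉ W := fun h => by simp [(hφ a).1 h] at ha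
  refine ⟨a, ?_, ?_, ?_, haW⟩ <;> rw [hN]
  · exact Or.inr rfl
  · exact Or.inl haW
  · exact Or.inl fun h => haW ((Submodule.add_mem_iff_right _ hwW).1 h)

theorem linearIndepOn_pair_zmod_two {V : Type*} [AddCommGroup V] [Module (ZMod 2) V] {a b : V}
    (ha : a ≠ 0) (hb : b ≠ 0) (hab : a ≠ b) : LinearIndepOn (ZMod 2) id {a, b} := by
  rw [LinearIndepOn.pair_iff _ hab]
  intro s t h
  have h01 : ∀ u : ZMod 2, u = 0 ∨ u = 1 := by decide
  rcases h01 s with rfl | rfl <;> rcases h01 t with rfl | rfl <;>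
    simp [ha, hb] at h ⊢
  have h2 : -b = b := by
    rw [← neg_one_smul (ZMod 2) b]
    rw [show (-1 : ZMod 2) = 1 from rfl, one_smul]
  exact hab (by rw [eq_neg_of_add_eq_zero_left h, h2])

/-- The triangle `w, a, w + a` is an odd circuit with only three elements, too few to have four
outside any `S`. -/
theorem not_nearIndependent_two (hW : Module.finrank (ZMod 2) W + 1 = N.rank) (hwW : w ∈ W)
    (hw : w ≠ 0) (hN : N.carrier = (W : Set (Fin N.rank → ZMod 2))ᶜ ∪ {w}) :
    ¬ N.NearIndependent 2 := by
  rintro ⟨-, H, hH, -, S, -, -, -, hodd⟩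
  -- Codimension `c - 2 = 0` leaves no choice for `H`.
  have hHtop : H = ⊤ := Submodule.eq_top_of_finrank_eq (by simpa using hH)
  obtain ⟨a, hwN, haN, hwaN, haW⟩ := exists_triangle hW hwW hN
  have ha0 : a ≠ 0 := fun h => haW (h ▸ W.zero_mem)
  have hwa0 : w + a ≠ 0 := fun h => haW ((Submodule.add_mem_iff_right _ hwW).1 (h ▸ W.zero_mem))
  have h1 : w ≠ a := fun h => haW (h ▸ hwW)
  have h2 : w ≠ w + a := by simpa using ha0
  have h3 : a ≠ w + a := by simpa using hw
  have hcard : ({w, a, w + a} : Set (Fin N.rank → ZMod 2)).ncard = 3 := by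
    rw [Set.ncard_eq_three]
    exact ⟨w, a, w + a, h1, h2, h3, rfl⟩
  have hcirc : IsCircuitOf (N.carrier ∩ H) {w, a, w + a} := by
    refine ⟨?_, ?_, ?_⟩
    · rw [hHtop]
      rintro x (rfl | rfl | rfl) <;> simp [hwN, haN, hwaN]
    · intro h
      rw [linearIndepOn_id_insert (by simp [h1, h2])] at h
      refine h.2 ?_
      have h6 := Submodule.sub_mem (Submodule.span (ZMod 2) {a, w + a})
        (Submodule.subset_span (Or.inr rfl)) (Submodule.subset_span (Or.inl rfl))
      simpa using h6
    · intro D hD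
      obtain ⟨x, hx, hxD⟩ := Set.exists_of_ssubset hD
      have hsub : D ⊆ {w, a, w + a} \ {x} := fun y hy => ⟨hD.1 hy, fun h => hxD (h ▸ hy)⟩
      simp only [Set.subset_def, Set.mem_sdiff, Set.mem_insert_iff, Set.mem_singleton_iff] at hsub
      rcases hx with rfl | rfl | rfl
      · refine (linearIndepOn_pair_zmod_two ha0 hwa0 h3).mono fun y hy => ?_
        grind
      · refine (linearIndepOn_pair_zmod_two hw hwa0 h2).mono fun y hy => ?_
        grind
      · refine (linearIndepOn_pair_zmod_two hw ha0 h1).mono fun y hy => ?_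
        grind
  have h4 := hodd _ hcirc (by rw [hcard]; decide)
  have h5 := Set.ncard_le_ncard (Set.sdiff_subset (s := {w, a, w + a})
    (t := (S : Set (Fin N.rank → ZMod 2)))) (Set.toFinite _)
  omega

end Family

end BinMatroid

/-! ### Fourier analysis on `𝔽₂ ^ n`. -/

open Finset

/-- The additive convolution of two real functions on `𝔽₂ ^ n`. -/
noncomputable def F2conv {n : ℕ} (f g : (Fin n → ZMod 2) → ℝ) (x : Fin n → ZMod 2) : ℝ :=
  ∑ y, f y * g (x + y)

/-- The characters of `𝔽₂ ^ n`. -/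
noncomputable def F2char {n : ℕ} (γ x : Fin n → ZMod 2) : ℝ := if γ ⬝ᵥ x = 0 then 1 else -1

/-- The unnormalised Fourier transform of a real function on `𝔽₂ ^ n`. -/
noncomputable def F2fourier {n : ℕ} (f : (Fin n → ZMod 2) → ℝ) (γ : Fin n → ZMod 2) : ℝ :=
  ∑ x, f x * F2char γ x

/-- The number of solutions of `x + y = z`, weighted by `f`. -/
noncomputable def F2triangles {n : ℕ} (f : (Fin n → ZMod 2) → ℝ) : ℝ :=
  ∑ x, ∑ y, f x * f y * f (x + y)

open Classical in
/-- The uniform probability measure on a subspace of `𝔽₂ ^ n`. -/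
noncomputable def F2unif {n : ℕ} (H : Submodule (ZMod 2) (Fin n → ZMod 2))
    (x : Fin n → ZMod 2) : ℝ :=
  if x ∈ H then (2 ^ Module.finrank (ZMod 2) H)⁻¹ else 0

section Fourier

variable {n : ℕ}

theorem F2_add_add_cancel (x y : Fin n → ZMod 2) : x + y + y = x := by
  rw [add_assoc, ZModModule.add_self, add_zero]

theorem F2char_add_right (γ x y : Fin n → ZMod 2) :
    F2char γ (x + y) = F2char γ x * F2char γ y := by
  unfold F2char
  rw [dotProduct_add]
  generalize γ ⬝ᵥ x = s
  generalize γ ⬝ᵥ y = t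
  have h : ∀ s t : ZMod 2, (s + t = 0 ↔ (s = 0 ↔ t = 0)) := by decide
  rw [if_congr (h s t) rfl rfl]
  by_cases hs : s = 0 <;> by_cases ht : t = 0 <;> simp [hs, ht]

theorem F2char_comm (γ x : Fin n → ZMod 2) : F2char γ x = F2char x γ := by
  simp [F2char, dotProduct_comm]

theorem card_F2 : (Fintype.card (Fin n → ZMod 2) : ℝ) = 2 ^ n := by simp

theorem sum_F2char (x : Fin n → ZMod 2) : ∑ γ, F2char γ x = if x = 0 then (2 : ℝ) ^ n else 0 := by
  split_ifs with hx
  · subst hx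
    simp [F2char]
  · obtain ⟨i, hi⟩ := Function.ne_iff.1 hx
    have h1 : F2char (Pi.single i 1) x = -1 := by
      have : ¬ x i = 0 := hi
      simp [F2char, this]
    have h2 := Equiv.sum_comp (Equiv.addRight (Pi.single i 1 : Fin n → ZMod 2))
      (fun γ => F2char γ x)
    have h3 : ∀ γ, F2char (γ + Pi.single i 1) x = - F2char γ x := fun γ => by
      rw [F2char_comm, F2char_add_right, F2char_comm, F2char_comm x, h1]; ring
    simp only [Equiv.coe_addRight, h3, sum_neg_distrib] at h2
    linarith

theorem sum_F2fourier (f : (Fin n → ZMod 2) → ℝ) : ∑ γ, F2fourier f γ = 2 ^ n * f 0 := by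
  unfold F2fourier
  rw [sum_comm]
  simp_rw [← mul_sum, sum_F2char]
  simp [mul_comm]

theorem F2fourier_conv (f g : (Fin n → ZMod 2) → ℝ) (γ : Fin n → ZMod 2) :
    F2fourier (F2conv f g) γ = F2fourier f γ * F2fourier g γ := by
  unfold F2fourier F2conv
  simp_rw [sum_mul_sum, sum_mul]
  rw [sum_comm]
  refine sum_congr rfl fun y _ => ?_
  rw [← Equiv.sum_comp (Equiv.addRight y)]
  refine sum_congr rfl fun x _ => ?_
  rw [Equiv.coe_addRight, F2_add_add_cancel, F2char_add_right]
  ring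

/-- Parseval: Fourier inversion at `0` for `f * f`. -/
theorem sum_F2fourier_sq (f : (Fin n → ZMod 2) → ℝ) :
    ∑ γ, F2fourier f γ ^ 2 = 2 ^ n * ∑ x, f x ^ 2 := by
  simp_rw [pow_two (F2fourier _ _), ← F2fourier_conv]
  rw [sum_F2fourier]
  simp [F2conv, pow_two]

/-- The triangle count is the value at `0` of `f * f * f`. -/
theorem sum_F2fourier_cube (f : (Fin n → ZMod 2) → ℝ) :
    ∑ γ, F2fourier f γ ^ 3 = 2 ^ n * F2triangles f := by
  simp_rw [pow_succ (F2fourier _ _), pow_zero, one_mul, ← F2fourier_conv]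
  rw [sum_F2fourier]
  congr 1
  simp only [F2conv, zero_add, F2triangles, sum_mul]
  refine sum_congr rfl fun x _ => sum_congr rfl fun y _ => ?_
  ring

variable (H : Submodule (ZMod 2) (Fin n → ZMod 2))

theorem F2unif_nonneg (x : Fin n → ZMod 2) : 0 ≤ F2unif H x := by
  unfold F2unif; split_ifs <;> positivity

theorem F2unif_le (x : Fin n → ZMod 2) : F2unif H x ≤ (2 ^ Module.finrank (ZMod 2) H)⁻¹ := by
  unfold F2unif; split_ifs <;> simp

theorem F2unif_add {h : Fin n → ZMod 2} (hh : h ∈ H) (x : Fin n → ZMod 2) :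
    F2unif H (x + h) = F2unif H x := by
  unfold F2unif
  rw [Submodule.add_mem_iff_left _ hh]

theorem sum_F2unif : ∑ x, F2unif H x = 1 := by
  classical
  have h1 : ((univ.filter (· ∈ H)).card : ℝ) = 2 ^ Module.finrank (ZMod 2) H := by
    have := Module.natCard_eq_pow_finrank (K := ZMod 2) (V := H)
    rw [Nat.card_zmod, Nat.card_eq_fintype_card, Fintype.card_subtype] at this
    exact_mod_cast this
  unfold F2unif
  rw [← sum_filter, sum_const, nsmul_eq_mul, h1, mul_inv_cancel₀ (by positivity)]

theorem sum_F2unif_add (x : Fin n → ZMod 2) : ∑ y, F2unif H (x + y) = 1 := by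
  rw [← sum_F2unif H]
  exact Equiv.sum_comp (Equiv.addLeft x) (F2unif H)

theorem F2fourier_unif_eq_one {γ : Fin n → ZMod 2} (h : ∀ x ∈ H, γ ⬝ᵥ x = 0) :
    F2fourier (F2unif H) γ = 1 := by
  rw [← sum_F2unif H]
  refine sum_congr rfl fun x _ => ?_
  by_cases hx : x ∈ H
  · simp [F2char, h x hx]
  · simp [F2unif, hx]

/-- Translation by `x` preserves the measure and flips the sign of the character. -/
theorem F2fourier_unif_eq_zero {γ x : Fin n → ZMod 2} (hx : x ∈ H) (h : γ ⬝ᵥ x ≠ 0) :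
    F2fourier (F2unif H) γ = 0 := by
  have h1 := Equiv.sum_comp (Equiv.addRight x) (fun y => F2unif H y * F2char γ y)
  have h2 : F2char γ x = -1 := by simp [F2char, h]
  simp only [Equiv.coe_addRight, F2unif_add H hx, F2char_add_right, h2, mul_neg, mul_one,
    sum_neg_distrib] at h1
  unfold F2fourier
  linarith

theorem exists_finrank_forall_dotProduct_eq_zero (s : Finset (Fin n → ZMod 2)) :
    ∃ H : Submodule (ZMod 2) (Fin n → ZMod 2), n ≤ Module.finrank (ZMod 2) H + s.card ∧
      ∀ γ ∈ s, ∀ x ∈ H, γ ⬝ᵥ x = 0 := by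
  let φ : (Fin n → ZMod 2) →ₗ[ZMod 2] (s → ZMod 2) :=
    Matrix.mulVecLin (Matrix.of fun γ : s => (γ : Fin n → ZMod 2))
  refine ⟨LinearMap.ker φ, ?_, fun γ hγ x hx => ?_⟩
  · have h1 := LinearMap.finrank_range_add_finrank_ker φ
    have h2 := Submodule.finrank_le (LinearMap.range φ)
    simp only [Module.finrank_fintype_fun_eq_card, Fintype.card_fin, Fintype.card_coe] at h1 h2
    omega
  · exact congrFun (LinearMap.mem_ker.1 hx) ⟨γ, hγ⟩

/-- Averaging over a subspace of bounded codimension hardly increases the number of solutions of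
`x + y = z`. -/
theorem exists_F2triangles_conv_unif_le {η : ℝ} (hη : 0 < η) {f : (Fin n → ZMod 2) → ℝ}
    (hf0 : ∀ x, 0 ≤ f x) (hf1 : ∀ x, f x ≤ 1) :
    ∃ H : Submodule (ZMod 2) (Fin n → ZMod 2),
      (n : ℝ) ≤ Module.finrank (ZMod 2) H + (η ^ 2)⁻¹ ∧
      F2triangles (F2conv f (F2unif H)) ≤ F2triangles f + η * 4 ^ n := by
  classical
  have h4 : (4 : ℝ) ^ n = 2 ^ n * 2 ^ n := by rw [← mul_pow]; norm_num
  have hsq : ∑ γ, F2fourier f γ ^ 2 ≤ 4 ^ n := by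
    rw [sum_F2fourier_sq, h4]
    refine mul_le_mul_of_nonneg_left ?_ (by positivity)
    calc ∑ x, f x ^ 2 ≤ ∑ x : Fin n → ZMod 2, (1 : ℝ) :=
          sum_le_sum fun x _ => pow_le_one₀ (hf0 x) (hf1 x)
      _ = 2 ^ n := by simp
  -- `H` annihilates every frequency with a large coefficient; by Parseval there are at most `1 / η
  -- ^ 2` of these.
  obtain ⟨H, hH, hs⟩ := exists_finrank_forall_dotProduct_eq_zero
    (univ.filter fun γ => η * 2 ^ n ≤ |F2fourier f γ|)
  refine ⟨H, ?_, ?_⟩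
  · have h1 : ((univ.filter fun γ => η * 2 ^ n ≤ |F2fourier f γ|).card : ℝ) * (η * 2 ^ n) ^ 2 ≤
        4 ^ n := by
      refine le_trans ?_ hsq
      rw [← nsmul_eq_mul]
      refine le_trans (card_nsmul_le_sum _ (fun γ => F2fourier f γ ^ 2) _ fun γ hγ => ?_)
        (sum_le_sum_of_subset_of_nonneg (filter_subset _ _) fun _ _ _ => sq_nonneg _)
      rw [← sq_abs (F2fourier f γ)]
      exact pow_le_pow_left₀ (by positivity) (mem_filter.1 hγ).2 2
    have h2 : (η * 2 ^ n) ^ 2 = η ^ 2 * 4 ^ n := by rw [h4]; ring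
    rw [h2, ← mul_assoc] at h1
    have h3 := le_of_mul_le_mul_right (h1.trans_eq (one_mul _).symm) (by positivity)
    rw [← le_div_iff₀ (by positivity), one_div] at h3
    have h5 : (n : ℝ) ≤ Module.finrank (ZMod 2) H +
      (univ.filter fun γ => η * 2 ^ n ≤ |F2fourier f γ|).card := by exact_mod_cast hH
    linarith
  -- Convolution keeps or kills each coefficient. Only killing a negative one raises the sum of
  -- cubes, and a killed coefficient is below `η * 2 ^ n` in absolute value.
  · have h1 : ∀ γ, F2fourier (F2conv f (F2unif H)) γ ^ 3 ≤
        F2fourier f γ ^ 3 + η * 2 ^ n * F2fourier f γ ^ 2 := by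
      intro γ
      rw [F2fourier_conv]
      have h0 : 0 ≤ η * 2 ^ n * F2fourier f γ ^ 2 := by positivity
      by_cases h : ∀ x ∈ H, γ ⬝ᵥ x = 0
      · rw [F2fourier_unif_eq_one H h, mul_one]
        linarith
      · push Not at h
        obtain ⟨x, hx, hne⟩ := h
        rw [F2fourier_unif_eq_zero H hx hne]
        have h2 : |F2fourier f γ| < η * 2 ^ n := by
          by_contra! hc
          exact hne (hs γ (by simpa using hc) x hx)
        have h3 := neg_abs_le (F2fourier f γ)
        have h5 : 0 ≤ (F2fourier f γ + η * 2 ^ n) * F2fourier f γ ^ 2 :=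
          mul_nonneg (by linarith) (sq_nonneg _)
        nlinarith
    have h2 := sum_le_sum fun γ (_ : γ ∈ univ) => h1 γ
    rw [sum_add_distrib, ← mul_sum, sum_F2fourier_cube, sum_F2fourier_cube] at h2
    have h3 : η * 2 ^ n * ∑ γ, F2fourier f γ ^ 2 ≤ η * 2 ^ n * 4 ^ n :=
      mul_le_mul_of_nonneg_left hsq (by positivity)
    refine le_of_mul_le_mul_left (a := (2 : ℝ) ^ n) ?_ (by positivity)
    linarith

end Fourier

/-! ### Cosets inside dense sets. -/

theorem sum_card_filter_add_mem {G : Type*} [AddGroup G] [Fintype G] [DecidableEq G]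
    (S : Finset G) : ∑ u, (S.filter fun x => x + u ∈ S).card = S.card ^ 2 := by
  simp_rw [card_filter]
  rw [sum_comm, pow_two, ← smul_eq_mul, ← sum_const]
  refine sum_congr rfl fun x _ => ?_
  rw [← card_filter, ← card_map (Equiv.addLeft x).toEmbedding]
  congr 1
  ext y
  simp only [mem_map_equiv, mem_filter, mem_univ, true_and]
  simp

/-- A dense subset of `𝔽₂ ^ n` that is invariant under a subspace `U` contains, for large `n`, a
coset of a subspace that extends `U` by a prescribed number of dimensions. -/
theorem exists_coset_subset_of_dense (d : ℕ) : ∀ (k : ℕ) {δ : ℝ}, 0 < δ → ∃ n₀ : ℕ, ∀ n ≥ n₀,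
    ∀ (S : Finset (Fin n → ZMod 2)) (U : Submodule (ZMod 2) (Fin n → ZMod 2)),
      Module.finrank (ZMod 2) U = k → (∀ x ∈ S, ∀ u ∈ U, x + u ∈ S) → δ * 2 ^ n ≤ S.card →
      ∃ U' ≥ U, Module.finrank (ZMod 2) U' = k + d ∧ ∃ x, ∀ u ∈ U', x + u ∈ S := by
  classical
  induction d with
  | zero =>
    refine fun k δ hδ => ⟨0, fun n _ S U hU hS hc => ⟨U, le_rfl, hU, ?_⟩⟩
    have h1 : (0 : ℝ) < S.card := lt_of_lt_of_le (by positivity) hc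
    obtain ⟨x, hx⟩ := card_pos.1 (by exact_mod_cast h1)
    exact ⟨x, hS x hx⟩
  | succ d ih =>
    intro k δ hδ
    -- The sizes of `S ∩ (S + u)` average at least `δ ^ 2 * 2 ^ n` over `u`. Half of this absorbs
    -- the `2 ^ k` shifts `u ∈ U`, negligible for large `n`, so some `u ∉ U` achieves the other
    -- half.
    obtain ⟨n₁, h₁⟩ := ih (k + 1) (δ := δ ^ 2 / 2) (by positivity)
    obtain ⟨n₂, h₂⟩ := pow_unbounded_of_one_lt (2 ^ k / (δ ^ 2 / 2)) (one_lt_two (α := ℝ))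
    refine ⟨max n₁ n₂, fun n hn S U hU hS hc => ?_⟩
    have hn1 : n₁ ≤ n := le_trans (le_max_left _ _) hn
    have hn2 : n₂ ≤ n := le_trans (le_max_right _ _) hn
    have hbig : (2 : ℝ) ^ k < δ ^ 2 / 2 * 2 ^ n := by
      rw [div_lt_iff₀ (by positivity)] at h₂
      have : (2 : ℝ) ^ n₂ ≤ 2 ^ n := pow_le_pow_right₀ one_le_two hn2
      nlinarith [sq_pos_of_pos hδ]
    obtain ⟨u, huU, hu⟩ : ∃ u ∉ U,
        δ ^ 2 / 2 * 2 ^ n ≤ ((S.filter fun x => x + u ∈ S).card : ℝ) := by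
      by_contra! h
      have hcardU : ((univ.filter (· ∈ U)).card : ℝ) = 2 ^ k := by
        have := Module.natCard_eq_pow_finrank (K := ZMod 2) (V := U)
        rw [Nat.card_zmod, Nat.card_eq_fintype_card, Fintype.card_subtype, hU] at this
        exact_mod_cast this
      have hSn : (S.card : ℝ) ≤ 2 ^ n := by
        have := card_le_univ S
        simp only [Fintype.card_pi, ZMod.card, prod_const, card_univ, Fintype.card_fin] at this
        exact_mod_cast this
      have hsum : (∑ u, ((S.filter fun x => x + u ∈ S).card : ℝ)) = S.card ^ 2 := by
        exact_mod_cast sum_card_filter_add_mem S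
      have hle : ∀ u, ((S.filter fun x => x + u ∈ S).card : ℝ) ≤
          (if u ∈ U then 2 ^ n else 0) + δ ^ 2 / 2 * 2 ^ n := by
        intro u
        split_ifs with hu
        · have : ((S.filter fun x => x + u ∈ S).card : ℝ) ≤ S.card := by
            exact_mod_cast card_filter_le _ _
          have : 0 < δ ^ 2 / 2 * 2 ^ n := by positivity
          linarith
        · linarith [h u hu]
      have hsum' := sum_le_sum fun u (_ : u ∈ univ) => hle u
      rw [hsum, sum_add_distrib, ← sum_filter, sum_const, sum_const, nsmul_eq_mul, hcardU,
        nsmul_eq_mul, card_univ] at hsum'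
      have hcard : ((Fintype.card (Fin n → ZMod 2) : ℕ) : ℝ) = 2 ^ n := by simp
      rw [hcard] at hsum'
      have h3 : (δ * 2 ^ n) ^ 2 ≤ (S.card : ℝ) ^ 2 := pow_le_pow_left₀ (by positivity) hc 2
      have h4 : (0 : ℝ) < 2 ^ n := by positivity
      nlinarith
    have hdim : Module.finrank (ZMod 2) (U ⊔ Submodule.span (ZMod 2) {u} : Submodule _ _) = k + 1 := by
      rw [← hU]
      have hu0 : u ≠ 0 := fun h => huU (h ▸ U.zero_mem)
      have hd : U ⊓ Submodule.span (ZMod 2) {u} = ⊥ := by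
        rw [eq_bot_iff]
        rintro y ⟨hy, hy'⟩
        obtain ⟨c, rfl⟩ := Submodule.mem_span_singleton.1 hy'
        by_cases hc : c = 0
        · simp [hc]
        · rw [ZMod.two_eq_one_of_ne_zero hc, one_smul] at hy
          exact absurd hy huU
      have := Submodule.finrank_sup_add_finrank_inf_eq U (Submodule.span (ZMod 2) {u})
      rw [hd, finrank_bot, finrank_span_singleton hu0] at this
      omega
    -- `S ∩ (S + u)` keeps the invariance under `U` and gains invariance under `u`, since `u + u =
    -- 0`.
    have hinv : ∀ x ∈ S.filter (fun x => x + u ∈ S), ∀ w ∈ U ⊔ Submodule.span (ZMod 2) {u},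
        x + w ∈ S.filter fun x => x + u ∈ S := by
      intro x hx w hw
      obtain ⟨y, hy, z, hz, rfl⟩ := Submodule.mem_sup.1 hw
      obtain ⟨c, rfl⟩ := Submodule.mem_span_singleton.1 hz
      rw [mem_filter] at hx ⊢
      by_cases hc : c = 0
      · subst hc
        rw [zero_smul, add_zero, add_right_comm]
        exact ⟨hS x hx.1 y hy, hS _ hx.2 y hy⟩
      · rw [ZMod.two_eq_one_of_ne_zero hc, one_smul]
        have h1 : x + (y + u) = x + u + y := by abel
        have h2 : x + (y + u) + u = x + y := by
          rw [← add_assoc, add_assoc _ u u, ZModModule.add_self, add_zero]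
        rw [h2, h1]
        exact ⟨hS _ hx.2 y hy, hS _ hx.1 y hy⟩
    obtain ⟨U', hU', hrank, x, hx⟩ := h₁ n hn1 _ _ hdim hinv hu
    exact ⟨U', le_sup_left.trans hU', by omega, x, fun v hv => (mem_filter.1 (hx v hv)).1⟩

/-! ### Rare differences and triangle counts. -/

section Density

variable {n : ℕ}

/-- If `f` takes values in `[0, 1]`, then on a coset of a subspace containing `v` the average of
`f` is at most about a half, provided `f z` and `f (z + v)` are rarely both large. -/
theorem two_mul_F2conv_unif_le (H : Submodule (ZMod 2) (Fin n → ZMod 2)) {v : Fin n → ZMod 2}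
    (hv : v ∈ H) {f : (Fin n → ZMod 2) → ℝ} (hf0 : ∀ x, 0 ≤ f x) (hf1 : ∀ x, f x ≤ 1)
    (x : Fin n → ZMod 2) :
    2 * F2conv f (F2unif H) x ≤
      1 + (∑ z, f z * f (z + v)) * (2 ^ Module.finrank (ZMod 2) H)⁻¹ := by
  have h1 : F2conv f (F2unif H) x = ∑ z, f (z + v) * F2unif H (x + z) := by
    unfold F2conv
    rw [← Equiv.sum_comp (Equiv.addRight v)]
    refine sum_congr rfl fun z _ => ?_
    rw [Equiv.coe_addRight, ← add_assoc, F2unif_add H hv]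
  have h2 : 2 * F2conv f (F2unif H) x = ∑ z, (f z + f (z + v)) * F2unif H (x + z) := by
    rw [two_mul]
    nth_rewrite 2 [h1]
    unfold F2conv
    rw [← sum_add_distrib]
    exact sum_congr rfl fun z _ => by ring
  rw [h2, ← sum_F2unif_add H x, sum_mul, ← sum_add_distrib]
  refine sum_le_sum fun z _ => ?_
  have h3 : f z * f (z + v) * F2unif H (x + z) ≤
      f z * f (z + v) * (2 ^ Module.finrank (ZMod 2) H)⁻¹ :=
    mul_le_mul_of_nonneg_left (F2unif_le H _) (mul_nonneg (hf0 _) (hf0 _))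
  -- This is `a + b ≤ 1 + a * b` for `a, b ≤ 1`, weighted by the measure.
  have h4 : 0 ≤ (1 - f z) * (1 - f (z + v)) * F2unif H (x + z) :=
    mul_nonneg (mul_nonneg (by linarith [hf1 z]) (by linarith [hf1 (z + v)])) (F2unif_nonneg H _)
  linarith

theorem sum_F2conv_unif (H : Submodule (ZMod 2) (Fin n → ZMod 2)) (f : (Fin n → ZMod 2) → ℝ) :
    ∑ x, F2conv f (F2unif H) x = ∑ x, f x := by
  unfold F2conv
  rw [sum_comm]
  refine sum_congr rfl fun y _ => ?_
  simp_rw [add_comm _ y]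
  rw [← mul_sum, sum_F2unif_add, mul_one]

/-- A function with average above `1/4` and values at most about `1/2` has many weighted solutions
of `x + y = z`. -/
theorem le_F2triangles {ε : ℝ} (hε : 0 < ε) {g : (Fin n → ZMod 2) → ℝ}
    (hg0 : ∀ x, 0 ≤ g x) (hg1 : ∀ x, g x ≤ 1 / 2 + ε / 4) (hg : (1 / 4 + ε) * 2 ^ n ≤ ∑ x, g x) :
    ε ^ 4 / 16 * 4 ^ n ≤ F2triangles g := by
  classical
  set R : Finset (Fin n → ZMod 2) := univ.filter fun x => ε / 2 ≤ g x with hR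
  have h2n : (0 : ℝ) < 2 ^ n := by positivity
  have hRn : (R.card : ℝ) ≤ 2 ^ n := by
    rw [← card_F2]; exact_mod_cast card_le_univ R
  have hRcard : (1 / 2 + ε / 2) * 2 ^ n ≤ (R.card : ℝ) := by
    -- Points outside `R` account for at most `ε / 2` of the mean, so the cap near `1/2` on `g`
    -- forces `R` to fill more than half of the space.
    have h1 : ∑ x, g x ≤ ∑ x, ((if x ∈ R then 1 / 2 + ε / 4 else 0) + ε / 2) := by
      refine sum_le_sum fun x _ => ?_
      split_ifs with hx
      · linarith [hg1 x]
      · rw [hR, mem_filter] at hx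
        push Not at hx
        linarith [hx (mem_univ x)]
    rw [sum_add_distrib, ← sum_filter, sum_const, sum_const, nsmul_eq_mul, nsmul_eq_mul,
      card_univ, card_F2, filter_univ_mem] at h1
    nlinarith
  -- Two sets of density at least `1/2 + ε/2` overlap in density at least `ε`.
  have hshift : ∀ x, ε * 2 ^ n ≤ ((R.filter fun y => x + y ∈ R).card : ℝ) := by
    intro x
    have h1 : (R.filter fun y => x + y ∈ R) = R ∩ (R.map (Equiv.addLeft x).toEmbedding) := by
      ext y
      simp only [mem_filter, mem_inter, mem_map_equiv, Equiv.addLeft_symm, Equiv.coe_addLeft,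
        ZModModule.neg_eq_self]
    have h2 := card_union_add_card_inter R (R.map (Equiv.addLeft x).toEmbedding)
    rw [← h1, card_map] at h2
    have h3 : ((R ∪ (R.map (Equiv.addLeft x).toEmbedding)).card : ℝ) ≤ 2 ^ n := by
      rw [← card_F2]; exact_mod_cast card_le_univ _
    have h4 : ((R ∪ (R.map (Equiv.addLeft x).toEmbedding)).card : ℝ) +
        ((R.filter fun y => x + y ∈ R).card : ℝ) = R.card + R.card := by exact_mod_cast h2
    linarith
  have hterm : ∀ x ∈ R, (ε / 2) ^ 3 * (ε * 2 ^ n) ≤ ∑ y, g x * g y * g (x + y) := by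
    intro x hx
    have h1 : ∀ y ∈ R.filter fun y => x + y ∈ R, (ε / 2) ^ 3 ≤ g x * g y * g (x + y) := by
      intro y hy
      simp only [hR, mem_filter, mem_univ, true_and] at hx hy
      have h0 : 0 ≤ ε / 2 := by positivity
      calc (ε / 2) ^ 3 = ε / 2 * (ε / 2) * (ε / 2) := by ring
        _ ≤ g x * g y * g (x + y) :=
          mul_le_mul (mul_le_mul hx hy.1 h0 (hg0 x)) hy.2 h0 (mul_nonneg (hg0 _) (hg0 _))
    have h2 := card_nsmul_le_sum _ _ _ h1
    rw [nsmul_eq_mul] at h2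
    have h3 : ((R.filter fun y => x + y ∈ R).card : ℝ) * (ε / 2) ^ 3 ≤
        ∑ y, g x * g y * g (x + y) :=
      h2.trans (sum_le_sum_of_subset_of_nonneg (subset_univ _)
        fun y _ _ => mul_nonneg (mul_nonneg (hg0 _) (hg0 _)) (hg0 _))
    have h4 := mul_le_mul_of_nonneg_right (hshift x) (show 0 ≤ (ε / 2) ^ 3 by positivity)
    linarith
  have h5 := card_nsmul_le_sum _ _ _ hterm
  rw [nsmul_eq_mul] at h5
  have h6 : (R.card : ℝ) * ((ε / 2) ^ 3 * (ε * 2 ^ n)) ≤ F2triangles g :=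
    h5.trans (sum_le_sum_of_subset_of_nonneg (subset_univ _) fun x _ _ =>
      sum_nonneg fun y _ => mul_nonneg (mul_nonneg (hg0 _) (hg0 _)) (hg0 _))
  refine le_trans ?_ h6
  have h7 : 1 / 2 * 2 ^ n ≤ (R.card : ℝ) := by nlinarith
  have h8 := mul_le_mul_of_nonneg_right h7 (show 0 ≤ (ε / 2) ^ 3 * (ε * 2 ^ n) by positivity)
  refine le_trans (le_of_eq ?_) h8
  rw [show (4 : ℝ) ^ n = 2 ^ n * 2 ^ n by rw [← mul_pow]; norm_num]
  ring

/-- A set of density above `1/4` in which every element is a rare difference avoids some subspace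
of bounded codimension. -/
theorem exists_subspace_disjoint_of_rare {ε : ℝ} (hε : 0 < ε) :
    ∃ (δ : ℝ) (k : ℕ), 0 < δ ∧ ∀ (n : ℕ) (A : Finset (Fin n → ZMod 2)),
      (1 / 4 + ε) * 2 ^ n ≤ (A.card : ℝ) →
      (∀ v ∈ A, ((A.filter fun x => x + v ∈ A).card : ℝ) ≤ δ * 2 ^ n) →
      ∃ H : Submodule (ZMod 2) (Fin n → ZMod 2),
        n ≤ Module.finrank (ZMod 2) H + k ∧ ∀ v ∈ H, v ∉ A := by
  classical
  set η : ℝ := ε ^ 4 / 64 with hη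
  have hη0 : 0 < η := by positivity
  obtain ⟨k, hk⟩ := exists_nat_ge ((η ^ 2)⁻¹)
  -- The first bound makes triangles rare. The second keeps differences rare relative to cosets of
  -- `H`, which may be smaller than the space by a factor `2 ^ k`.
  refine ⟨min η (ε / 2 / 2 ^ k), k, by positivity, fun n A hA hrare => ?_⟩
  set f : (Fin n → ZMod 2) → ℝ := fun x => if x ∈ A then 1 else 0 with hf
  have hf0 : ∀ x, 0 ≤ f x := fun x => by simp only [hf]; split_ifs <;> norm_num
  have hf1 : ∀ x, f x ≤ 1 := fun x => by simp only [hf]; split_ifs <;> norm_num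
  have hfsum : ∑ x, f x = A.card := by simp [hf]
  have hfshift : ∀ v, ∑ z, f z * f (z + v) = ((A.filter fun x => x + v ∈ A).card : ℝ) := by
    intro v
    simp only [hf, card_filter, Nat.cast_sum, ite_mul, one_mul, zero_mul]
    rw [← sum_filter, filter_univ_mem]
    refine sum_congr rfl fun x _ => ?_
    split_ifs <;> simp
  obtain ⟨H, hH, hT⟩ := exists_F2triangles_conv_unif_le hη0 hf0 hf1
  have hHk : n ≤ Module.finrank (ZMod 2) H + k := by
    have : (n : ℝ) ≤ Module.finrank (ZMod 2) H + k := by linarith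
    exact_mod_cast this
  refine ⟨H, hHk, fun v hvH hvA => ?_⟩
  have hg1 : ∀ x, F2conv f (F2unif H) x ≤ 1 / 2 + ε / 4 := by
    intro x
    have h1 := two_mul_F2conv_unif_le H hvH hf0 hf1 x
    rw [hfshift] at h1
    have h2 : ((A.filter fun x => x + v ∈ A).card : ℝ) ≤ ε / 2 / 2 ^ k * 2 ^ n :=
      (hrare v hvA).trans (mul_le_mul_of_nonneg_right (min_le_right _ _) (by positivity))
    have h3 : ((A.filter fun x => x + v ∈ A).card : ℝ) *
        (2 ^ Module.finrank (ZMod 2) H)⁻¹ ≤ ε / 2 := by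
      rw [← div_eq_mul_inv, div_le_iff₀ (by positivity)]
      refine h2.trans ?_
      have h4 : (2 : ℝ) ^ n ≤ 2 ^ Module.finrank (ZMod 2) H * 2 ^ k := by
        rw [← pow_add]; exact pow_le_pow_right₀ one_le_two hHk
      calc ε / 2 / 2 ^ k * 2 ^ n ≤ ε / 2 / 2 ^ k * (2 ^ Module.finrank (ZMod 2) H * 2 ^ k) :=
            mul_le_mul_of_nonneg_left h4 (by positivity)
        _ = _ := by field_simp
    linarith
  have hg0 : ∀ x, 0 ≤ F2conv f (F2unif H) x := fun x =>
    sum_nonneg fun y _ => mul_nonneg (hf0 y) (F2unif_nonneg H _)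
  have h1 := le_F2triangles hε hg0 hg1 (by rw [sum_F2conv_unif, hfsum]; exact hA)
  have h2 : F2triangles f ≤ η * 4 ^ n := by
    have h3 : F2triangles f = ∑ x ∈ A, ((A.filter fun y => y + x ∈ A).card : ℝ) := by
      have h4 : ∀ x, ∑ y, f x * f y * f (x + y) =
          f x * ((A.filter fun y => y + x ∈ A).card : ℝ) := fun x => by
        rw [← hfshift, mul_sum]
        exact sum_congr rfl fun y _ => by rw [mul_assoc, add_comm x y]
      unfold F2triangles
      simp_rw [h4]
      simp [hf]
    have h4 : ∀ x ∈ A, ((A.filter fun y => y + x ∈ A).card : ℝ) ≤ η * 2 ^ n := fun x hx =>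
      (hrare x hx).trans (mul_le_mul_of_nonneg_right (min_le_left _ _) (by positivity))
    have h5 := sum_le_card_nsmul _ _ _ h4
    rw [nsmul_eq_mul] at h5
    rw [h3]
    refine h5.trans ?_
    have h6 : (A.card : ℝ) ≤ 2 ^ n := by
      rw [← card_F2]; exact_mod_cast card_le_univ A
    calc (A.card : ℝ) * (η * 2 ^ n) ≤ 2 ^ n * (η * 2 ^ n) :=
          mul_le_mul_of_nonneg_right h6 (by positivity)
      _ = η * 4 ^ n := by
        rw [show (4 : ℝ) ^ n = 2 ^ n * 2 ^ n by rw [← mul_pow]; norm_num]; ring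
  -- The upper bound `2 * η * 4 ^ n = ε ^ 4 / 32 * 4 ^ n` contradicts the lower bound `ε ^ 4 / 16 *
  -- 4 ^ n`.
  have h3 : (0 : ℝ) < ε ^ 4 * 4 ^ n := by positivity
  rw [hη] at h2 hT
  nlinarith

end Density

/-! ### The upper bound on the threshold. -/

namespace BinMatroid

theorem criticalNumber_le_of_disjoint {M : BinMatroid} {k : ℕ}
    {H : Submodule (ZMod 2) (Fin M.rank → ZMod 2)}
    (hk : M.rank ≤ Module.finrank (ZMod 2) H + k) (hH : ∀ v ∈ H, v ∉ M.carrier) :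
    M.criticalNumber ≤ k := by
  have h1 : Module.finrank (ZMod 2) H ≤ M.rank := by simpa using Submodule.finrank_le H
  have h2 : M.criticalNumber ≤ M.rank - Module.finrank (ZMod 2) H :=
    Nat.sInf_le ⟨H, by omega, Set.disjoint_left.2 hH⟩
  omega

theorem criticalNumber_le_rank (M : BinMatroid) : M.criticalNumber ≤ M.rank := by
  obtain ⟨W, hW, -⟩ := criticalNumberOf_spec M.zero_notMem
  change _ + M.criticalNumber = _ at hW
  omega

/-- Matroids of density above `1/4` contain `N_{ℓ,2,1}` or have bounded critical number. -/
theorem mem_thresholdSet_of_quarter_lt {N : BinMatroid}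
    {W : Submodule (ZMod 2) (Fin N.rank → ZMod 2)} {w : Fin N.rank → ZMod 2}
    (hℓ : 2 ≤ N.rank)
    (hW : Module.finrank (ZMod 2) W + 1 = N.rank) (hwW : w ∈ W) (hw : w ≠ 0)
    (hN : N.carrier = (W : Set (Fin N.rank → ZMod 2))ᶜ ∪ {w}) {α : ℝ} (hα : 1 / 4 < α) :
    α ∈ N.thresholdSet := by
  classical
  refine ⟨by linarith, ?_⟩
  obtain ⟨δ, k, hδ, hk⟩ := exists_subspace_disjoint_of_rare (sub_pos.2 hα)
  -- Extending the line of `v` by `N.rank - 2` dimensions gives the dimension `N.rank - 1` of `W`.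
  obtain ⟨n₀, hn₀⟩ := exists_coset_subset_of_dense (N.rank - 2) 1 hδ
  refine ⟨max k n₀, fun M hM => or_iff_not_imp_left.2 fun hfree => ?_⟩
  rcases lt_or_ge M.rank n₀ with hlt | hge
  · exact M.criticalNumber_le_rank.trans (hlt.le.trans (le_max_right _ _))
  have hA : ((M.carrier.toFinset.card : ℕ) : ℝ) = M.carrier.ncard := by
    rw [Set.ncard_eq_toFinset_card']
  have hrare : ∀ v ∈ M.carrier.toFinset,
      ((M.carrier.toFinset.filter fun x => x + v ∈ M.carrier.toFinset).card : ℝ) ≤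
        δ * 2 ^ M.rank := by
    intro v hv
    by_contra! hdense
    have hvM : v ∈ M.carrier := by simpa using hv
    have hv0 : v ≠ 0 := fun h => M.zero_notMem (h ▸ hvM)
    have hinv : ∀ x ∈ M.carrier.toFinset.filter (fun x => x + v ∈ M.carrier.toFinset),
        ∀ u ∈ Submodule.span (ZMod 2) {v},
          x + u ∈ M.carrier.toFinset.filter fun x => x + v ∈ M.carrier.toFinset := by
      intro x hx u hu
      obtain ⟨c, rfl⟩ := Submodule.mem_span_singleton.1 hu
      by_cases hc : c = 0
      · simpa [hc] using hx
      · rw [ZMod.two_eq_one_of_ne_zero hc, one_smul]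
        rw [mem_filter] at hx ⊢
        rw [F2_add_add_cancel]
        exact hx.symm
    obtain ⟨U, hU, hrank, x, hx⟩ := hn₀ M.rank hge _ (Submodule.span (ZMod 2) {v})
      (finrank_span_singleton hv0) hinv hdense.le
    refine hfree (contains_of_affine_subset hW hwW hw hN (U := U) (v := v) (x := x) (by omega)
      (hU (Submodule.mem_span_singleton_self v)) hvM fun u hu => ?_)
    simpa using (mem_filter.1 (hx u hu)).1
  obtain ⟨H, hH, hd⟩ := hk M.rank M.carrier.toFinset (by rw [hA]; linarith) hrare
  exact (criticalNumber_le_of_disjoint hH fun v hv => by simpa using hd v hv).trans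
    (le_max_left _ _)

end BinMatroid

/-- A weak form of Stirling, enough for `centralBinom n = o(4 ^ n)`; the induction closes because
`(2n + 1)(2n + 3) ≤ 4(n + 1) ^ 2`. -/
theorem two_mul_add_one_mul_centralBinom_sq_le (n : ℕ) :
    (2 * n + 1) * n.centralBinom ^ 2 ≤ 16 ^ n := by
  induction n with
  | zero => simp
  | succ n ih =>
    have h := Nat.succ_mul_centralBinom_succ n
    refine le_of_mul_le_mul_left (a := (n + 1) ^ 2) ?_ (by positivity)
    calc (n + 1) ^ 2 * ((2 * (n + 1) + 1) * (n + 1).centralBinom ^ 2)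
        = (2 * (n + 1) + 1) * ((n + 1) * (n + 1).centralBinom) ^ 2 := by ring
      _ = 4 * (2 * n + 3) * (2 * n + 1) * ((2 * n + 1) * n.centralBinom ^ 2) := by rw [h]; ring
      _ ≤ 4 * (2 * n + 3) * (2 * n + 1) * 16 ^ n := Nat.mul_le_mul_left _ ih
      _ ≤ (n + 1) ^ 2 * 16 * 16 ^ n := Nat.mul_le_mul_right _ (by nlinarith)
      _ = (n + 1) ^ 2 * 16 ^ (n + 1) := by ring

theorem exists_mul_centralBinom_le (C : ℝ) {ε : ℝ} (hε : 0 < ε) :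
    ∃ n₀ : ℕ, ∀ n ≥ n₀, C * n.centralBinom ≤ ε * 4 ^ n := by
  obtain ⟨n₀, h₀⟩ := exists_nat_ge ((C / ε) ^ 2)
  refine ⟨n₀, fun n hn => ?_⟩
  have h1 : ((2 * n + 1 : ℕ) : ℝ) * (n.centralBinom : ℝ) ^ 2 ≤ 16 ^ n := by
    exact_mod_cast two_mul_add_one_mul_centralBinom_sq_le n
  have h2 : (C / ε) ^ 2 ≤ (2 * n + 1 : ℕ) := by
    have : (n₀ : ℝ) ≤ n := by exact_mod_cast hn
    push_cast
    linarith [(Nat.cast_nonneg n : (0 : ℝ) ≤ n)]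
  have h3 : (C / ε * n.centralBinom) ^ 2 ≤ (4 ^ n) ^ 2 := by
    rw [mul_pow, ← pow_mul, mul_comm n 2, pow_mul, show (4 : ℝ) ^ 2 = 16 by norm_num]
    exact (mul_le_mul_of_nonneg_right h2 (sq_nonneg _)).trans h1
  have h4 := abs_le_of_sq_le_sq h3 (by positivity)
  have h5 := mul_le_mul_of_nonneg_left ((le_abs_self _).trans h4) hε.le
  rwa [← mul_assoc, mul_div_cancel₀ _ hε.ne'] at h5

/-! ### Weights in the Hamming cube. -/

section Hamming

variable {m : ℕ}

theorem hammingNorm_add_le (x y : Fin m → ZMod 2) :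
    hammingNorm (x + y) ≤ hammingNorm x + hammingNorm y := by
  have := hammingDist_triangle x 0 y
  rw [hammingDist_zero_right, hammingDist_zero_left, hammingDist_eq_hammingNorm,
    ZModModule.neg_eq_self] at this
  exact this

theorem hammingNorm_add_one (x : Fin m → ZMod 2) :
    hammingNorm x + hammingNorm (x + 1) = m := by
  have h : ∀ t : ZMod 2, t + 1 ≠ 0 ↔ ¬ t ≠ 0 := by decide
  simp only [hammingNorm, Pi.add_apply, Pi.one_apply, h]
  rw [card_filter_add_card_filter_not]
  simp

theorem card_hammingNorm_eq_le (k : ℕ) :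
    ((univ : Finset (Fin m → ZMod 2)).filter fun x => hammingNorm x = k).card ≤ m.choose k := by
  have h1 : (powersetCard k (univ : Finset (Fin m))).card = m.choose k := by simp
  rw [← h1]
  refine card_le_card_of_injOn (fun x => univ.filter fun i => x i ≠ 0) ?_ ?_
  · intro x hx
    exact mem_coe.2 (mem_powersetCard.2 ⟨subset_univ _, (mem_filter.1 hx).2⟩)
  · intro x _ y _ h
    ext i
    have h2 := congrArg (i ∈ ·) h
    simp only [mem_filter, mem_univ, true_and] at h2
    have h3 : ∀ s t : ZMod 2, ((s ≠ 0) = (t ≠ 0)) → s = t := by decide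
    rw [h3 _ _ h2]

/-- Almost half of the vectors of `𝔽₂ ^ (2 n)` have weight at most `n - t / 2`. -/
theorem two_pow_le_two_mul_card_low (n t : ℕ) :
    2 ^ (2 * n) ≤ 2 * ((univ : Finset (Fin (2 * n) → ZMod 2)).filter
      fun x => 2 * hammingNorm x + t < 2 * n).card + (2 * t + 1) * n.centralBinom := by
  classical
  set L := (univ : Finset (Fin (2 * n) → ZMod 2)).filter fun x => 2 * hammingNorm x + t < 2 * n
  -- Complementation `x ↦ x + 1` matches light and heavy vectors; the rest lie in at most `2 * t +
  -- 1` middle layers, each no larger than the central one.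
  have h1 : (univ : Finset (Fin (2 * n) → ZMod 2)) ⊆ (L ∪ L.image (· + 1)) ∪
      (Icc (n - t) (n + t)).biUnion fun k => univ.filter fun x => hammingNorm x = k := by
    intro x _
    have h2 := hammingNorm_add_one x
    by_cases h3 : 2 * hammingNorm x + t < 2 * n
    · exact mem_union_left _ (mem_union_left _ (by simp [L, h3]))
    by_cases h4 : 2 * hammingNorm (x + 1) + t < 2 * n
    · refine mem_union_left _ (mem_union_right _ (mem_image.2 ⟨x + 1, by simp [L, h4], ?_⟩))
      exact F2_add_add_cancel x 1
    · refine mem_union_right _ (mem_biUnion.2 ⟨hammingNorm x, mem_Icc.2 ?_, by simp⟩)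
      omega
  have h2 := card_le_card h1
  have h3 : ((Icc (n - t) (n + t)).biUnion fun k =>
      (univ : Finset (Fin (2 * n) → ZMod 2)).filter fun x => hammingNorm x = k).card ≤
      (2 * t + 1) * n.centralBinom := by
    refine (card_biUnion_le_card_mul _ _ n.centralBinom fun k _ =>
      (card_hammingNorm_eq_le k).trans (Nat.choose_le_centralBinom k n)).trans ?_
    refine Nat.mul_le_mul_right _ ?_
    rw [Nat.card_Icc]; omega
  have h4 : (L.image (· + 1)).card ≤ L.card := card_image_le
  have h5 := card_union_le (L ∪ L.image (· + 1)) ((Icc (n - t) (n + t)).biUnion fun k =>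
      (univ : Finset (Fin (2 * n) → ZMod 2)).filter fun x => hammingNorm x = k)
  have h6 := card_union_le L (L.image (· + 1))
  have h7 : (univ : Finset (Fin (2 * n) → ZMod 2)).card = 2 ^ (2 * n) := by simp
  omega

end Hamming

/-! ### Borsuk–Hajnal sets and the lower bound. -/

/-- Every subspace of small codimension contains a vector that vanishes at `0` and at few other
coordinates. -/
theorem exists_mem_hammingNorm_tail_ge {m c : ℕ}
    (W : Submodule (ZMod 2) (Fin (m + 1) → ZMod 2))
    (hW : m + 1 ≤ Module.finrank (ZMod 2) W + c) :
    ∃ x ∈ W, x 0 = 0 ∧ m ≤ hammingNorm (Fin.tail x) + c := by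
  classical
  let e : Fin m → (Fin (m + 1) → ZMod 2) := fun i => Pi.single i.succ 1
  -- Modulo `W`, at most `c` of the `e i` span all of them. The sum of all `e i` is thus congruent
  -- to a combination of these few, and the difference lies in `W`.
  obtain ⟨κ, a, ha, hspan, hli⟩ := exists_linearIndependent' (ZMod 2) fun i => W.mkQ (e i)
  have : Finite κ := Finite.of_injective a ha
  have := Fintype.ofFinite κ
  have hκ : Fintype.card κ ≤ c := by
    have h1 := hli.fintype_card_le_finrank
    have h2 := W.finrank_quotient_add_finrank
    rw [Module.finrank_fin_fun] at h2
    omega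
  have hmem : W.mkQ (∑ i, e i) ∈
      Submodule.span (ZMod 2) (Set.range ((fun i => W.mkQ (e i)) ∘ a)) := by
    rw [hspan, map_sum]
    exact Submodule.sum_mem _ fun i _ => Submodule.subset_span ⟨i, rfl⟩
  obtain ⟨b, hb⟩ := (Submodule.mem_span_range_iff_exists_fun (ZMod 2)).1 hmem
  have he : ∀ (i : Fin m) (j : Fin m), e i j.succ = if i = j then 1 else 0 := fun i j => by
    simp [e, Pi.single_apply, eq_comm]
  have he0 : ∀ i : Fin m, e i 0 = 0 := fun i => by
    simp [e, (Fin.succ_ne_zero i).symm]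
  refine ⟨∑ i, e i - ∑ j, b j • e (a j), ?_, ?_, ?_⟩
  · rw [← Submodule.ker_mkQ W, LinearMap.mem_ker, map_sub, ← hb, map_sum]
    simp
  · simp [he0]
  · have h1 : univ \ univ.image a ⊆ univ.filter fun j : Fin m =>
        Fin.tail (∑ i, e i - ∑ j, b j • e (a j)) j ≠ 0 := by
      intro j hj
      have hj' : ∀ k, a k ≠ j := by simpa using hj
      simp [Fin.tail, he, hj']
    have h2 := card_le_card h1
    have h3 := le_card_sdiff (univ.image a) (univ : Finset (Fin m))
    have h4 : (univ.image a).card ≤ Fintype.card κ := card_image_le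
    rw [card_univ, Fintype.card_fin] at h3
    change _ ≤ hammingNorm _ at h2
    omega

/-- A dense triangle-free set: the vectors that start with `0` and have few other zeros, and those
that start with `1` and have slightly more zeros than ones elsewhere. -/
def borsukHajnalSet (m t : ℕ) : Set (Fin (m + 1) → ZMod 2) :=
  {x | (x 0 = 0 ∧ m ≤ hammingNorm (Fin.tail x) + t) ∨
    (x 0 = 1 ∧ 2 * hammingNorm (Fin.tail x) + t < m)}

theorem tail_F2add {m : ℕ} (x y : Fin (m + 1) → ZMod 2) :
    Fin.tail (x + y) = Fin.tail x + Fin.tail y := rfl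

/-- First coordinates allow two cases. Two vectors with few zeros sum to weight at most `2 * t < m -
t`, and two light vectors sum to weight below `m - t`; neither sum has few zeros. -/
theorem borsukHajnalSet_triangle_free {m t : ℕ} (hm : 3 * t < m) {x y : Fin (m + 1) → ZMod 2}
    (hx : x ∈ borsukHajnalSet m t) (hy : y ∈ borsukHajnalSet m t) :
    x + y ∉ borsukHajnalSet m t := by
  have h1 := hammingNorm_add_le (Fin.tail x) (Fin.tail y)
  have h2 := hammingNorm_add_le (Fin.tail x) (Fin.tail x + Fin.tail y)
  have h3 := hammingNorm_add_le (Fin.tail x + Fin.tail y) (Fin.tail y)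
  have h4 := hammingNorm_add_le (Fin.tail x + 1) (Fin.tail y + 1)
  have h5 := hammingNorm_add_one (Fin.tail x)
  have h6 := hammingNorm_add_one (Fin.tail y)
  rw [← add_assoc, ZModModule.add_self, zero_add] at h2
  rw [F2_add_add_cancel] at h3
  rw [add_add_add_comm, ZModModule.add_self, add_zero] at h4
  rintro (⟨hz, hz'⟩ | ⟨hz, hz'⟩) <;> rcases hx with ⟨hx, hx'⟩ | ⟨hx, hx'⟩ <;>
    rcases hy with ⟨hy, hy'⟩ | ⟨hy, hy'⟩ <;>
    rw [Pi.add_apply, hx, hy] at hz <;> rw [tail_F2add] at hz' <;>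
    first
      | omega
      | exact absurd hz (by decide)

theorem zero_notMem_borsukHajnalSet {m t : ℕ} (hm : t < m) : 0 ∉ borsukHajnalSet m t := by
  have h : Fin.tail (0 : Fin (m + 1) → ZMod 2) = 0 := rfl
  rintro (⟨-, h1⟩ | ⟨h1, -⟩)
  · rw [h, hammingNorm_zero] at h1; omega
  · exact absurd h1 zero_ne_one

/-- The set contains `e₀` and every `e₀ + eᵢ`, all light outside the first coordinate. -/
theorem span_borsukHajnalSet {m t : ℕ} (hm : t + 2 < m) :
    Submodule.span (ZMod 2) (borsukHajnalSet m t) = ⊤ := by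
  classical
  have h0 : (Pi.single 0 1 : Fin (m + 1) → ZMod 2) ∈
      Submodule.span (ZMod 2) (borsukHajnalSet m t) := by
    refine Submodule.subset_span (Or.inr ⟨by simp, ?_⟩)
    have : Fin.tail (Pi.single 0 1 : Fin (m + 1) → ZMod 2) = 0 := by
      ext i; simp [Fin.tail]
    rw [this, hammingNorm_zero]; omega
  have h1 : ∀ i : Fin m, (Pi.single 0 1 + Pi.single i.succ 1 : Fin (m + 1) → ZMod 2) ∈
      Submodule.span (ZMod 2) (borsukHajnalSet m t) := by
    intro i
    refine Submodule.subset_span (Or.inr ⟨by simp [(Fin.succ_ne_zero i).symm], ?_⟩)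
    have h2 : hammingNorm (Fin.tail (Pi.single 0 1 + Pi.single i.succ 1 :
        Fin (m + 1) → ZMod 2)) ≤ 1 := by
      refine (card_le_card (t := {i}) fun j hj => ?_).trans (card_singleton i).le
      by_contra hji
      simp [Fin.tail, Pi.single_apply] at hj hji
      exact hji hj
    omega
  rw [eq_top_iff, ← (Pi.basisFun (ZMod 2) (Fin (m + 1))).span_eq, Submodule.span_le]
  rintro _ ⟨i, rfl⟩
  rw [Pi.basisFun_apply]
  induction i using Fin.cases with
  | zero => exact h0
  | succ i => simpa using Submodule.sub_mem _ (h1 i) h0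

theorem card_low_le_ncard_borsukHajnalSet (m t : ℕ) :
    ((univ : Finset (Fin m → ZMod 2)).filter fun x => 2 * hammingNorm x + t < m).card ≤
      (borsukHajnalSet m t).ncard := by
  have hinj : Function.Injective fun x : Fin m → ZMod 2 => (Fin.cons 1 x : Fin (m + 1) → ZMod 2) :=
    fun x y h => by simpa using congrArg Fin.tail h
  rw [← Set.ncard_coe_finset, ← Set.ncard_image_of_injective _ hinj]
  refine Set.ncard_le_ncard ?_ (Set.toFinite _)
  rintro _ ⟨x, hx, rfl⟩
  exact Or.inr ⟨rfl, by simpa using hx⟩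

namespace BinMatroid

theorem exists_dense_triangle_free {α : ℝ} (hα : α < 1 / 4) (c : ℕ) :
    ∃ M : BinMatroid, α * 2 ^ M.rank ≤ (M.carrier.ncard : ℝ) ∧ c < M.criticalNumber ∧
      ∀ x ∈ M.carrier, ∀ y ∈ M.carrier, x + y ∉ M.carrier := by
  -- The middle layers cost `(2 * c + 1) * centralBinom n`, and `(1 - 4 * α) * 4 ^ n` is the slack
  -- in the density.
  obtain ⟨n₀, h₀⟩ := exists_mul_centralBinom_le (2 * c + 1) (ε := 1 - 4 * α) (by linarith)
  set n := max n₀ (3 * c + 3) with hn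
  have hnc : 3 * c + 3 ≤ n := le_max_right _ _
  refine ⟨⟨2 * n + 1, by omega, borsukHajnalSet (2 * n) c,
    zero_notMem_borsukHajnalSet (by omega), span_borsukHajnalSet (by omega)⟩, ?_, ?_,
    fun x hx y hy => borsukHajnalSet_triangle_free (by omega) hx hy⟩
  · have h1 := h₀ n (le_max_left _ _)
    have h2 := two_pow_le_two_mul_card_low n c
    have h3 := card_low_le_ncard_borsukHajnalSet (2 * n) c
    have h4 : (2 : ℝ) ^ (2 * n) ≤ 2 * (borsukHajnalSet (2 * n) c).ncard +
        (2 * c + 1) * n.centralBinom := by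
      exact_mod_cast h2.trans (Nat.add_le_add_right (Nat.mul_le_mul_left 2 h3) _)
    rw [pow_mul, show (2 : ℝ) ^ 2 = 4 by norm_num] at h4
    change α * 2 ^ (2 * n + 1) ≤ ((borsukHajnalSet (2 * n) c).ncard : ℝ)
    rw [pow_succ, pow_mul, show (2 : ℝ) ^ 2 = 4 by norm_num]
    linarith
  · by_contra! h
    obtain ⟨W, hW, hd⟩ := criticalNumberOf_spec
      (zero_notMem_borsukHajnalSet (m := 2 * n) (t := c) (by omega))
    change criticalNumberOf (borsukHajnalSet (2 * n) c) ≤ c at h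
    obtain ⟨x, hxW, hx⟩ := exists_mem_hammingNorm_tail_ge (c := c) W (by omega)
    exact Set.disjoint_left.1 hd hxW (Or.inl hx)

end BinMatroid

theorem mainTheorem4 (ℓ : ℕ) (hℓ : 2 ≤ ℓ) (N : BinMatroid) (hN : BinMatroid.IsNFamily ℓ 2 1 N) :
    N.criticalThreshold = 1 / 4 ∧ N.SatisfiesGeelenNelson := by
  have hrank : 2 ≤ N.rank := hN.1 ▸ hℓ
  obtain ⟨W, w, hW, hwW, hw, hc⟩ := hN.exists_hyperplane
  have hθ : N.criticalThreshold = 1 / 4 := by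
    have hglb := N.isGLB_criticalThreshold
    refine le_antisymm ?_ ?_
    · refine le_of_forall_gt_imp_ge_of_dense fun α hα => hglb.1 ?_
      exact BinMatroid.mem_thresholdSet_of_quarter_lt hrank hW hwW hw hc hα
    · refine hglb.2 fun α hα => ?_
      by_contra! hlt
      obtain ⟨-, c, hM⟩ := hα
      obtain ⟨M, hdense, hχ, hfree⟩ := BinMatroid.exists_dense_triangle_free hlt c
      rcases hM M hdense with ⟨ι, -, hι⟩ | h
      · obtain ⟨a, h1, h2, h3, -⟩ := BinMatroid.exists_triangle hW hwW hc
        refine hfree _ (hι ⟨w, h1, rfl⟩) _ (hι ⟨a, h2, rfl⟩) ?_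
        rw [← map_add]
        exact hι ⟨_, h3, rfl⟩
      · omega
  -- Both equivalences hold with both sides false: an independent flat exists and near-independence
  -- fails.
  refine ⟨hθ, 3, by norm_num, ?_, ?_, ?_⟩
  · rw [BinMatroid.criticalNumber_eq_two hW hwW hw hc]
    simpa using BinMatroid.hasIndependentFlat_two hW hw hc
  · rw [BinMatroid.criticalNumber_eq_two hW hwW hw hc]
    simpa using BinMatroid.not_nearIndependent_two hW hwW hw hc
  · rw [hθ, BinMatroid.criticalNumber_eq_two hW hwW hw hc]
    norm_num
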